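/- For a finite graph $G$ with at least one vertex let $\mathrm{Mad}(G)=\max\{2e(H)/|V(H)| : H\subseteq G,\ V(H)\neq\emptyset\}$ be its maximum average degree. A $k$-decomposition of the complete graph $K_n$ is a family $(G_1,\dots,G_k)$ of spanning subgraphs of $K_n$, possibly edgeless, whose edge sets are pairwise disjoint and have union $E(K_n)$. Let $M(k,n)=\max\sum_{i=1}^k\mathrm{Mad}(G_i)$, the maximum being taken over all $k$-decompositions of $K_n$. Let $P_3$ denote the path on $3$ vertices. Multisets of graphs are understood up to isomorphism and after deleting the isolated vertices of each graph. **Theorem.** Let $k=\binom n2-t$, where $t$ is an integer with $0\le t\le \frac13(n-1)^2$. (i) If $t$ is even, then $M(k,n)=\binom n2-\frac t2$. This maximum is attained, and a $k$-decomposition $(G_1,\dots,G_k)$ of $K_n$ attains it if and only if the multiset of its members consists of $\frac t2$ copies of $K_3$ and $\binom n2-\frac{3t}2$ copies of $K_2$. (ii) If $t$ is odd, then $M(k,n)=\binom n2-\frac{t+1}2+\frac13$. This maximum is attained, and a $k$-decomposition $(G_1,\dots,G_k)$ of $K_n$ attains it if and only if the multiset of its members consists of $\frac{t-1}2$ copies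 of $K_3$, $\binom n2-2-\frac{3(t-1)}2$ copies of $K_2$, and one copy of $P_3$. -/

import Mathlib

namespace MadDecomp

/-- The average degree `d(H) = 2 e(H) / |H|` of a subgraph `H`. -/
noncomputable def avgDeg {V : Type} {G : SimpleGraph V} (H : G.Subgraph) : ℝ :=
  2 * (H.edgeSet.ncard : ℝ) / (H.verts.ncard : ℝ)

/-- The maximum average degree `Mad(G)`: the maximum of `d(H)` over all subgraphs `H` of `G`
with at least one vertex. (For a finite graph this is a supremum over a finite set.) -/
noncomputable def Mad {V : Type} (G : SimpleGraph V) : ℝ :=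
  sSup {x : ℝ | ∃ H : G.Subgraph, H.verts.Nonempty ∧ x = avgDeg H}

/-- `(G_1, …, G_k)` is a `k`-decomposition of `K_n`: spanning subgraphs of `K_n` whose edge sets
are pairwise disjoint and together give all edges of `K_n`. Edgeless `G_i` are allowed. -/
structure IsDecomposition {k n : ℕ} (G : Fin k → SimpleGraph (Fin n)) : Prop where
  disjoint : ∀ i j : Fin k, i ≠ j → Disjoint (G i).edgeSet (G j).edgeSet
  cover : (⋃ i : Fin k, (G i).edgeSet) = (⊤ : SimpleGraph (Fin n)).edgeSet

/-- All values `Mad(G_1) + … + Mad(G_k)` over the `k`-decompositions of `K_n`. -/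
def madSums (k n : ℕ) : Set ℝ :=
  {x : ℝ | ∃ G : Fin k → SimpleGraph (Fin n), IsDecomposition G ∧ x = ∑ i : Fin k, Mad (G i)}

/-- The extremal function `M(k, n)`, the maximum of `madSums k n`. -/
noncomputable def M (k n : ℕ) : ℝ := sSup (madSums k n)

/-- A graph together with its vertex type, so that graphs on different vertex sets can be put
into one multiset. -/
structure Graph where
  V : Type
  graph : SimpleGraph V

/-- Isomorphism of graphs. -/
def Graph.Iso (A B : Graph) : Prop := Nonempty (A.graph ≃g B.graph)

/-- The complete graph on `m` vertices. -/
def K (m : ℕ) : Graph := ⟨Fin m, ⊤⟩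

/-- The path on `m` vertices. -/
def P (m : ℕ) : Graph := ⟨Fin m, SimpleGraph.pathGraph m⟩

open Classical in
/-- The support of `G`: the subgraph induced by the non-isolated vertices, and `K_1` if `G` has
no edges. -/
noncomputable def supp {V : Type} (G : SimpleGraph V) : Graph :=
  if G = ⊥ then K 1 else ⟨G.support, G.induce G.support⟩

/-- The members of the family `G`, taken without their isolated vertices and up to isomorphism,
form the multiset `S`: there is a bijection, respecting multiplicities, that matches each
member with an isomorphic graph in `S`. -/
def FormsMultiset {k n : ℕ} (G : Fin k → SimpleGraph (Fin n)) (S : Multiset Graph) : Prop :=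
  Multiset.Rel Graph.Iso ((Finset.univ : Finset (Fin k)).val.map (fun i => supp (G i))) S

/-- `S` is the unique extremal multiset for `M(k, n)`: the maximum is attained, and the
`k`-decompositions of `K_n` attaining it are exactly those forming the multiset `S`. -/
def IsUniqueExtremal (k n : ℕ) (S : Multiset Graph) : Prop :=
  IsGreatest (madSums k n) (M k n) ∧
    ∀ G : Fin k → SimpleGraph (Fin n), IsDecomposition G →
      (∑ i : Fin k, Mad (G i) = M k n ↔ FormsMultiset G S)

end MadDecomp

/-! Let e_i be the number of edges of G_i, so that t is the sum of the e_i - 1. In a graph with e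
edges, a subgraph on at least four vertices has average degree at most e/2. Inspecting the subgraphs
on at most three vertices then gives Mad ≤ e/2 for every graph except, up to isolated vertices, K_2,
K_3 and P_3 (`iso_or_Mad_le`). For these three, 2 Mad equals e + 1, e + 1 and e + 2/3.

Summing 2 Mad ≤ e + 1, a decomposition with any other member has total at most C(n,2) - (t+1)/2,
strictly below the claimed value (`IsDecomposition.cases`). With a triangles, b edges and c paths, t
= 2a + c and the total is C(n,2) - t/2 - c/6. Since c has the parity of t, the optimum is c = t mod
2, and this determines a and b.

Attaining the value requires ⌊t/2⌋ edge-disjoint triangles (`hasTriplePacking_of_le`). For odd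
orders they come from the Bose and Skolem constructions and a variant for 5 mod 6, all sharing the
three-level scheme `HasTriplePacking.of_diagonal`; for even orders a point is deleted. For odd t the
uncovered edges number more than n/2, so two of them meet and form P_3. All remaining edges become
single members. -/

namespace MadDecomp

/-! ### Bounds on the maximum average degree by the number of edges. -/

section MadBounds

variable {V : Type} {G : SimpleGraph V}

theorem finite_avgDegs [Finite V] (G : SimpleGraph V) :
    {x : ℝ | ∃ H : G.Subgraph, H.verts.Nonempty ∧ x = avgDeg H}.Finite := by
  refine (Set.finite_range (fun H : G.Subgraph => avgDeg H)).subset ?_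
  rintro x ⟨H, -, rfl⟩
  exact ⟨H, rfl⟩

theorem avgDeg_le_Mad [Finite V] (H : G.Subgraph) (hH : H.verts.Nonempty) : avgDeg H ≤ Mad G :=
  le_csSup (finite_avgDegs G).bddAbove ⟨H, hH, rfl⟩

theorem exists_avgDeg_eq_Mad [Finite V] [Nonempty V] (G : SimpleGraph V) :
    ∃ H : G.Subgraph, H.verts.Nonempty ∧ Mad G = avgDeg H := by
  refine Set.Nonempty.csSup_mem (s := {x : ℝ | ∃ H : G.Subgraph, H.verts.Nonempty ∧ x = avgDeg H})
    ?_ (finite_avgDegs G)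
  exact ⟨_, ⊤, by simp, rfl⟩

/-- This serves n = 0, where the supremum is over the empty set and takes the default value 0. -/
theorem Mad_of_isEmpty [IsEmpty V] (G : SimpleGraph V) : Mad G = 0 := by
  have : {x : ℝ | ∃ H : G.Subgraph, H.verts.Nonempty ∧ x = avgDeg H} = ∅ := by
    ext x
    simp only [Set.mem_ofPred_eq, Set.mem_empty_iff_false, iff_false, not_exists, not_and]
    rintro H ⟨v, -⟩
    exact isEmptyElim v
  rw [Mad, this, Real.sSup_empty]

theorem Subgraph.edgeSet_ncard_le [Finite V] (H : G.Subgraph) : H.edgeSet.ncard ≤ G.edgeSet.ncard :=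
  Set.ncard_le_ncard H.edgeSet_subset (Set.toFinite _)

theorem Subgraph.edgeSet_eq_empty (H : G.Subgraph) {a : V} (h : H.verts = {a}) :
    H.edgeSet = ∅ := by
  ext e
  induction e with | _ x y
  simp only [SimpleGraph.Subgraph.mem_edgeSet, Set.mem_empty_iff_false, iff_false]
  intro hxy
  have hx := H.edge_vert hxy
  have hy := H.edge_vert hxy.symm
  rw [h] at hx hy
  exact hxy.ne (hx.trans hy.symm)

theorem Subgraph.edgeSet_subset_pair (H : G.Subgraph) {a b : V} (h : H.verts = {a, b}) :
    H.edgeSet ⊆ {s(a, b)} := by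
  intro e
  induction e with | _ x y
  simp only [SimpleGraph.Subgraph.mem_edgeSet, Set.mem_singleton_iff]
  intro hxy
  have hx := H.edge_vert hxy
  have hy := H.edge_vert hxy.symm
  have hne := hxy.ne
  rw [h] at hx hy
  rcases hx with rfl | rfl <;> rcases hy with rfl | rfl <;> simp_all [Sym2.eq_swap]

theorem Subgraph.edgeSet_subset_triple (H : G.Subgraph) {a b c : V} (h : H.verts = {a, b, c}) :
    H.edgeSet ⊆ {s(a, b), s(a, c), s(b, c)} := by
  intro e
  induction e with | _ x y
  simp only [SimpleGraph.Subgraph.mem_edgeSet, Set.mem_singleton_iff, Set.mem_insert_iff]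
  intro hxy
  have hx := H.edge_vert hxy
  have hy := H.edge_vert hxy.symm
  have hne := hxy.ne
  rw [h] at hx hy
  rcases hx with rfl | rfl | rfl <;> rcases hy with rfl | rfl | rfl <;> simp_all [Sym2.eq_swap]

/-- The five cases for a subgraph, by its number of vertices. -/
theorem Subgraph.avgDeg_cases [Finite V] (H : G.Subgraph) (hH : H.verts.Nonempty) :
    avgDeg H = 0 ∨ (∃ a b, a ≠ b ∧ H.edgeSet = {s(a, b)} ∧ avgDeg H = 1) ∨
    (∃ a b c, a ≠ b ∧ a ≠ c ∧ b ≠ c ∧ H.verts = {a, b, c} ∧ H.edgeSet.ncard ≤ 3 ∧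
      avgDeg H = 2 * H.edgeSet.ncard / 3) ∨ avgDeg H ≤ (G.edgeSet.ncard : ℝ) / 2 := by
  have hpos : 0 < H.verts.ncard := (Set.ncard_pos (Set.toFinite _)).2 hH
  have hle := Subgraph.edgeSet_ncard_le H
  obtain h | h | h | h : H.verts.ncard = 1 ∨ H.verts.ncard = 2 ∨ H.verts.ncard = 3 ∨
      4 ≤ H.verts.ncard := by omega
  · left
    obtain ⟨a, ha⟩ := Set.ncard_eq_one.1 h
    simp [avgDeg, Subgraph.edgeSet_eq_empty H ha]
  · obtain ⟨a, b, hab, hv⟩ := Set.ncard_eq_two.1 h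
    rcases Set.subset_singleton_iff_eq.1 (Subgraph.edgeSet_subset_pair H hv) with h0 | h1
    · left; simp [avgDeg, h0]
    · right; left
      exact ⟨a, b, hab, h1, by simp [avgDeg, h1, h]⟩
  · obtain ⟨a, b, c, hab, hac, hbc, hv⟩ := Set.ncard_eq_three.1 h
    right; right; left
    refine ⟨a, b, c, hab, hac, hbc, hv, ?_, by simp [avgDeg, h]⟩
    refine (Set.ncard_le_ncard (Subgraph.edgeSet_subset_triple H hv) (Set.toFinite _)).trans ?_
    refine (Set.ncard_insert_le _ _).trans ?_
    have := Set.ncard_insert_le s(a, c) {s(b, c)}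
    rw [Set.ncard_singleton] at this
    omega
  · right; right; right
    have h' : (4 : ℝ) ≤ H.verts.ncard := by exact_mod_cast h
    have hle' : (H.edgeSet.ncard : ℝ) ≤ G.edgeSet.ncard := by exact_mod_cast hle
    have h0 : (0 : ℝ) ≤ G.edgeSet.ncard := by positivity
    rw [avgDeg, div_le_div_iff₀ (by linarith) (by norm_num)]
    nlinarith

theorem Mad_le_of_two_le [Finite V] (h : 2 ≤ G.edgeSet.ncard) : Mad G ≤ 2 * (G.edgeSet.ncard : ℝ) / 3 := by
  have h' : (2 : ℝ) ≤ G.edgeSet.ncard := by exact_mod_cast h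
  cases isEmpty_or_nonempty V
  · rw [Mad_of_isEmpty]; positivity
  obtain ⟨H, hH, e⟩ := exists_avgDeg_eq_Mad G
  have hle : (H.edgeSet.ncard : ℝ) ≤ G.edgeSet.ncard := by
    exact_mod_cast Subgraph.edgeSet_ncard_le H
  rw [e]
  rcases Subgraph.avgDeg_cases H hH with h1 | ⟨a, b, -, -, h1⟩ | ⟨a, b, c, -, -, -, -, -, h1⟩ | h1
  · rw [h1]; positivity
  · linarith
  · linarith
  · linarith

theorem Mad_le_one [Finite V] (h : G.edgeSet.ncard = 1) : Mad G ≤ 1 := by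
  cases isEmpty_or_nonempty V
  · rw [Mad_of_isEmpty]; norm_num
  obtain ⟨H, hH, e⟩ := exists_avgDeg_eq_Mad G
  have hle : (H.edgeSet.ncard : ℝ) ≤ 1 := by
    exact_mod_cast h ▸ Subgraph.edgeSet_ncard_le H
  rw [e]
  rcases Subgraph.avgDeg_cases H hH with h1 | ⟨a, b, -, -, h1⟩ | ⟨a, b, c, -, -, -, -, -, h1⟩ | h1
  · linarith
  · linarith
  · linarith
  · rw [h] at h1; norm_num at h1; linarith

end MadBounds

/-! ### Recognising K_2, K_3 and P_3 up to isolated vertices. -/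

section Supp

variable {V : Type}

theorem iso_supp_map {W : Type} (B : SimpleGraph W) (hB : B ≠ ⊥) (hs : B.support = Set.univ)
    (f : W ↪ V) : Graph.Iso (supp (B.map f)) ⟨W, B⟩ := by
  have hne : B.map f ≠ ⊥ := by
    intro h
    apply hB
    ext a b
    rw [← SimpleGraph.map_adj_apply (f := f), h]
    simp
  have hsupp : ∀ v : W, f v ∈ (B.map f).support := by
    intro v
    rw [SimpleGraph.support_map, hs]
    exact ⟨v, trivial, rfl⟩
  unfold supp
  rw [if_neg hne]
  refine ⟨(SimpleGraph.Iso.symm ⟨Equiv.ofBijective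
    (fun v => (⟨f v, hsupp v⟩ : (B.map f).support)) ⟨?_, ?_⟩, ?_⟩)⟩
  · intro a b hab
    exact f.injective (congrArg Subtype.val hab)
  · rintro ⟨w, hw⟩
    rw [SimpleGraph.support_map] at hw
    obtain ⟨v, -, rfl⟩ := hw
    exact ⟨v, rfl⟩
  · intro a b
    exact SimpleGraph.map_adj_apply

/-- Turns an isomorphism of supports into an embedded copy, whose edges and average degree can be
counted. The assumption on `B` rules out the convention `supp ⊥ = K 1`. -/
theorem exists_eq_map_of_iso_supp {G : SimpleGraph V} {B : Graph} (hB : B.graph ≠ ⊥)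
    (h : Graph.Iso (supp G) B) : ∃ f : B.V ↪ V, G = B.graph.map f := by
  obtain ⟨e⟩ := h
  have hG : G ≠ ⊥ := by
    intro hG
    rw [supp, if_pos hG] at e
    apply hB
    ext a b
    rw [← e.symm.map_adj_iff]
    have : Subsingleton (K 1).V := inferInstanceAs (Subsingleton (Fin 1))
    simp only [SimpleGraph.bot_adj, iff_false]
    intro hab
    exact hab.ne (Subsingleton.elim _ _)
  rw [supp, if_neg hG] at e
  refine ⟨e.symm.toEquiv.toEmbedding.trans (Function.Embedding.subtype _), ?_⟩
  ext a b
  rw [SimpleGraph.map_adj]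
  constructor
  · intro hab
    have ha : a ∈ G.support := ⟨b, hab⟩
    have hb : b ∈ G.support := ⟨a, hab.symm⟩
    refine ⟨e ⟨a, ha⟩, e ⟨b, hb⟩, ?_, ?_, ?_⟩
    · rw [e.map_adj_iff]; exact hab
    · simp
    · simp
  · rintro ⟨u, v, huv, rfl, rfl⟩
    rw [← e.symm.map_adj_iff] at huv
    exact huv

theorem ncard_edgeSet_map (B : Graph) (f : B.V ↪ V) :
    (B.graph.map f).edgeSet.ncard = B.graph.edgeSet.ncard := by
  rw [SimpleGraph.edgeSet_map, Set.ncard_image_of_injective _ f.sym2Map.injective]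

theorem le_Mad_map [Finite V] (B : Graph) [Nonempty B.V] (f : B.V ↪ V) :
    2 * (B.graph.edgeSet.ncard : ℝ) / Nat.card B.V ≤ Mad (B.graph.map f) := by
  let H : (B.graph.map f).Subgraph :=
    { verts := Set.range f
      Adj := (B.graph.map f).Adj
      adj_sub := id
      edge_vert := by
        intro v w h
        obtain ⟨u, -, -, rfl, -⟩ := (SimpleGraph.map_adj _ _ _ _).1 h
        exact ⟨u, rfl⟩
      symm := (B.graph.map f).symm }
  have h1 : H.edgeSet = (B.graph.map f).edgeSet := by
    ext e
    induction e with | _ x y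
    rfl
  have h2 : H.verts.ncard = Nat.card B.V := by
    change (Set.range f).ncard = _
    rw [← Set.image_univ, Set.ncard_image_of_injective _ f.injective, Set.ncard_univ]
  have h3 := avgDeg_le_Mad H (Set.range_nonempty _)
  rwa [avgDeg, h1, h2, ncard_edgeSet_map] at h3

theorem K_graph_ne_bot {m : ℕ} (hm : 2 ≤ m) : (K m).graph ≠ ⊥ := by
  intro h
  have : (K m).graph.Adj (⟨0, by omega⟩ : Fin m) (⟨1, by omega⟩ : Fin m) := by
    change (⟨0, by omega⟩ : Fin m) ≠ (⟨1, by omega⟩ : Fin m)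
    simp
  rw [h] at this
  exact this

theorem P_three_graph_ne_bot : (P 3).graph ≠ ⊥ := by
  intro h
  have : (P 3).graph.Adj (0 : Fin 3) (1 : Fin 3) := by
    change (SimpleGraph.pathGraph 3).Adj 0 1
    simp [SimpleGraph.pathGraph_adj]
  rw [h] at this
  exact this

theorem ncard_edgeSet_K_two : (K 2).graph.edgeSet.ncard = 1 := by
  change ((⊤ : SimpleGraph (Fin 2)).edgeSet).ncard = 1
  rw [← SimpleGraph.coe_edgeFinset, Set.ncard_coe_finset,
    SimpleGraph.card_edgeFinset_top_eq_card_choose_two]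
  rfl

theorem ncard_edgeSet_K_three : (K 3).graph.edgeSet.ncard = 3 := by
  change ((⊤ : SimpleGraph (Fin 3)).edgeSet).ncard = 3
  rw [← SimpleGraph.coe_edgeFinset, Set.ncard_coe_finset,
    SimpleGraph.card_edgeFinset_top_eq_card_choose_two]
  rfl

theorem edgeSet_pathGraph_three :
    (SimpleGraph.pathGraph 3).edgeSet = {s(0, 1), s(1, 2)} := by
  ext e
  induction e with | _ x y
  rw [SimpleGraph.mem_edgeSet, SimpleGraph.pathGraph_adj]
  fin_cases x <;> fin_cases y <;> simp

theorem ncard_edgeSet_P_three : (P 3).graph.edgeSet.ncard = 2 := by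
  change (SimpleGraph.pathGraph 3).edgeSet.ncard = 2
  rw [edgeSet_pathGraph_three]
  exact Set.ncard_pair (by decide)

instance (m : ℕ) [NeZero m] : Nonempty (K m).V := inferInstanceAs (Nonempty (Fin m))
instance (m : ℕ) [NeZero m] : Nonempty (P m).V := inferInstanceAs (Nonempty (Fin m))

theorem natCard_K (m : ℕ) : Nat.card (K m).V = m := Nat.card_fin m
theorem natCard_P (m : ℕ) : Nat.card (P m).V = m := Nat.card_fin m

variable {G : SimpleGraph V}

theorem Mad_of_iso_K_two [Finite V] (h : Graph.Iso (supp G) (K 2)) :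
    Mad G = 1 ∧ G.edgeSet.ncard = 1 := by
  obtain ⟨f, rfl⟩ := exists_eq_map_of_iso_supp (K_graph_ne_bot le_rfl) h
  have he := (ncard_edgeSet_map (K 2) f).trans ncard_edgeSet_K_two
  refine ⟨le_antisymm (Mad_le_one he) ?_, he⟩
  have := le_Mad_map (K 2) f
  rw [ncard_edgeSet_K_two, natCard_K] at this
  norm_num at this
  exact this

theorem Mad_of_iso_K_three [Finite V] (h : Graph.Iso (supp G) (K 3)) :
    Mad G = 2 ∧ G.edgeSet.ncard = 3 := by
  obtain ⟨f, rfl⟩ := exists_eq_map_of_iso_supp (K_graph_ne_bot (by norm_num)) h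
  have he := (ncard_edgeSet_map (K 3) f).trans ncard_edgeSet_K_three
  refine ⟨le_antisymm ?_ ?_, he⟩
  · have := Mad_le_of_two_le (G := (K 3).graph.map f) (by omega)
    rw [he] at this
    norm_num at this
    exact this
  · have := le_Mad_map (K 3) f
    rw [ncard_edgeSet_K_three, natCard_K] at this
    norm_num at this
    exact this

theorem Mad_of_iso_P_three [Finite V] (h : Graph.Iso (supp G) (P 3)) :
    Mad G = 4 / 3 ∧ G.edgeSet.ncard = 2 := by
  obtain ⟨f, rfl⟩ := exists_eq_map_of_iso_supp P_three_graph_ne_bot h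
  have he := (ncard_edgeSet_map (P 3) f).trans ncard_edgeSet_P_three
  refine ⟨le_antisymm ?_ ?_, he⟩
  · have := Mad_le_of_two_le (G := (P 3).graph.map f) (by omega)
    rw [he] at this
    norm_num at this
    exact this
  · have := le_Mad_map (P 3) f
    rw [ncard_edgeSet_P_three, natCard_P] at this
    norm_num at this
    exact this

theorem iso_K_two_of_edgeSet {a b : V} (hab : a ≠ b) (h : G.edgeSet = {s(a, b)}) :
    Graph.Iso (supp G) (K 2) := by
  let f : Fin 2 ↪ V := ⟨![a, b], by
    intro i j hij
    fin_cases i <;> fin_cases j <;> simp_all⟩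
  have hG : G = (⊤ : SimpleGraph (Fin 2)).map f := by
    rw [← SimpleGraph.edgeSet_inj, h, SimpleGraph.edgeSet_map]
    have : (⊤ : SimpleGraph (Fin 2)).edgeSet = {s(0, 1)} := by
      ext e
      induction e with | _ x y
      fin_cases x <;> fin_cases y <;> simp
    rw [this, Set.image_singleton]
    rfl
  rw [hG]
  refine iso_supp_map _ (K_graph_ne_bot (m := 2) le_rfl) ?_ f
  refine Set.eq_univ_of_forall fun v => ?_
  have : ∃ w : Fin 2, (⊤ : SimpleGraph (Fin 2)).Adj v w :=
    (by decide : ∀ v : Fin 2, ∃ w, (⊤ : SimpleGraph (Fin 2)).Adj v w) v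
  exact this

theorem triple_injective {a b c : V} (hab : a ≠ b) (hac : a ≠ c) (hbc : b ≠ c) :
    Function.Injective ![a, b, c] := by
  intro i j hij
  fin_cases i <;> fin_cases j <;> simp_all

theorem iso_K_three_of_edgeSet {a b c : V} (hab : a ≠ b) (hac : a ≠ c) (hbc : b ≠ c)
    (h : G.edgeSet = {s(a, b), s(a, c), s(b, c)}) : Graph.Iso (supp G) (K 3) := by
  let f : Fin 3 ↪ V := ⟨![a, b, c], triple_injective hab hac hbc⟩
  have hG : G = (⊤ : SimpleGraph (Fin 3)).map f := by
    rw [← SimpleGraph.edgeSet_inj, h, SimpleGraph.edgeSet_map]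
    have : (⊤ : SimpleGraph (Fin 3)).edgeSet = {s(0, 1), s(0, 2), s(1, 2)} := by
      ext e
      induction e with | _ x y
      fin_cases x <;> fin_cases y <;> simp
    rw [this, Set.image_insert_eq, Set.image_insert_eq, Set.image_singleton]
    rfl
  rw [hG]
  refine iso_supp_map _ (K_graph_ne_bot (m := 3) (by norm_num)) ?_ f
  refine Set.eq_univ_of_forall fun v => ?_
  have : ∃ w : Fin 3, (⊤ : SimpleGraph (Fin 3)).Adj v w :=
    (by decide : ∀ v : Fin 3, ∃ w, (⊤ : SimpleGraph (Fin 3)).Adj v w) v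
  exact this

theorem iso_P_three_of_edgeSet {a b c : V} (hab : a ≠ b) (hac : a ≠ c) (hbc : b ≠ c)
    (h : G.edgeSet = {s(a, b), s(b, c)}) : Graph.Iso (supp G) (P 3) := by
  let f : Fin 3 ↪ V := ⟨![a, b, c], triple_injective hab hac hbc⟩
  have hG : G = (SimpleGraph.pathGraph 3).map f := by
    rw [← SimpleGraph.edgeSet_inj, h, SimpleGraph.edgeSet_map, edgeSet_pathGraph_three,
      Set.image_insert_eq, Set.image_singleton]
    rfl
  rw [hG]
  refine iso_supp_map _ P_three_graph_ne_bot ?_ f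
  refine Set.eq_univ_of_forall fun v => ?_
  have hP : ∀ v : Fin 3, ∃ w, (SimpleGraph.pathGraph 3).Adj v w := by
    simp only [SimpleGraph.pathGraph_adj]
    decide
  exact hP v

theorem exists_edge_of_ncard_eq_one (h : G.edgeSet.ncard = 1) :
    ∃ a b, a ≠ b ∧ G.edgeSet = {s(a, b)} := by
  obtain ⟨e, he⟩ := Set.ncard_eq_one.1 h
  induction e with | _ a b
  refine ⟨a, b, ?_, he⟩
  have : s(a, b) ∈ G.edgeSet := by rw [he]; rfl
  exact SimpleGraph.Adj.ne (G := G) this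

theorem eq_pair_of_subset_triple {α : Type*} {x y z : α} {s : Set α} (hs : s ⊆ {x, y, z})
    (h2 : s.ncard = 2) : s = {x, y} ∨ s = {x, z} ∨ s = {y, z} := by
  obtain ⟨p, q, hpq, rfl⟩ := Set.ncard_eq_two.1 h2
  have hp := hs (Set.mem_insert p _)
  have hq := hs (Set.mem_insert_of_mem p (Set.mem_singleton q))
  rcases hp with rfl | rfl | rfl <;> rcases hq with rfl | rfl | rfl <;>
    simp_all [Set.pair_comm]

/-- A graph either is, up to isolated vertices, one of `K_2`, `K_3`, `P_3`, or its maximum average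
degree is at most half its number of edges. -/
theorem iso_or_Mad_le [Finite V] (G : SimpleGraph V) :
    Graph.Iso (supp G) (K 3) ∨ Graph.Iso (supp G) (K 2) ∨ Graph.Iso (supp G) (P 3) ∨
      Mad G ≤ (G.edgeSet.ncard : ℝ) / 2 := by
  cases isEmpty_or_nonempty V
  · right; right; right
    rw [Mad_of_isEmpty]; positivity
  obtain ⟨H, hH, hM⟩ := exists_avgDeg_eq_Mad G
  by_cases h1 : G.edgeSet.ncard = 1
  · obtain ⟨a, b, hab, h⟩ := exists_edge_of_ncard_eq_one h1
    exact Or.inr (Or.inl (iso_K_two_of_edgeSet hab h))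
  have hle := Subgraph.edgeSet_ncard_le H
  have heq : H.edgeSet.ncard = G.edgeSet.ncard → H.edgeSet = G.edgeSet := fun h =>
    Set.eq_of_subset_of_ncard_le H.edgeSet_subset h.ge (Set.toFinite _)
  rw [hM]
  rcases Subgraph.avgDeg_cases H hH with
    h | ⟨a, b, hab, hE, h⟩ | ⟨a, b, c, hab, hac, hbc, hv, h3, h⟩ | h
  · right; right; right; rw [h]; positivity
  · right; right; right
    rw [hE, Set.ncard_singleton] at hle
    have : (2 : ℝ) ≤ G.edgeSet.ncard := by exact_mod_cast (by omega : 2 ≤ G.edgeSet.ncard)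
    linarith
  · have hsub := Subgraph.edgeSet_subset_triple H hv
    by_cases h33 : G.edgeSet.ncard = 3 ∧ H.edgeSet.ncard = 3
    · left
      refine iso_K_three_of_edgeSet hab hac hbc ?_
      rw [← heq (by omega)]
      refine Set.eq_of_subset_of_ncard_le hsub ?_ (Set.toFinite _)
      rw [h33.2]
      refine (Set.ncard_insert_le _ _).trans ?_
      have := Set.ncard_insert_le s(a, c) {s(b, c)}
      rw [Set.ncard_singleton] at this
      omega
    by_cases h22 : G.edgeSet.ncard = 2 ∧ H.edgeSet.ncard = 2
    · right; right; left
      have hGH := heq (by omega)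
      rw [hGH] at hsub h22
      rcases eq_pair_of_subset_triple hsub h22.2 with h' | h' | h'
      · exact iso_P_three_of_edgeSet hab.symm hbc hac (by rw [h', Sym2.eq_swap])
      · exact iso_P_three_of_edgeSet hab hac hbc (by rw [h'])
      · exact iso_P_three_of_edgeSet hac hab hbc.symm (by rw [h', Sym2.eq_swap (a := b)])
    right; right; right
    -- `H` has at most 3 edges. With the cases e = 1, (3, 3) and (2, 2) removed, 3 edges in `H`
    -- force at least 4 in `G`, 2 force at least 3, and 1 forces at least 2.
    have : 4 * H.edgeSet.ncard ≤ 3 * G.edgeSet.ncard := by omega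
    have : (4 : ℝ) * H.edgeSet.ncard ≤ 3 * G.edgeSet.ncard := by exact_mod_cast this
    rw [h]; linarith
  · exact Or.inr (Or.inr (Or.inr h))

end Supp

/-! ### Triple packings: general operations. -/

/-- A family of triples in `S` no two of which share a pair of points. -/
structure IsTriplePacking {V : Type} (S : Finset V) (𝒯 : Finset (Finset V)) : Prop where
  subset : ∀ T ∈ 𝒯, T ⊆ S
  card : ∀ T ∈ 𝒯, T.card = 3
  unique : ∀ T ∈ 𝒯, ∀ U ∈ 𝒯, ∀ p q, p ≠ q → p ∈ T → q ∈ T → p ∈ U → q ∈ U → T = U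

/-- Some `n`-point set carries at least `s` triples, no two of them sharing a pair of points. -/
def HasTriplePacking (n s : ℕ) : Prop :=
  ∃ (V : Type) (S : Finset V) (𝒯 : Finset (Finset V)),
    S.card = n ∧ s ≤ 𝒯.card ∧ IsTriplePacking S 𝒯

theorem IsTriplePacking.mono {V : Type} {S : Finset V} {𝒯 𝒰 : Finset (Finset V)}
    (h : IsTriplePacking S 𝒯) (h' : 𝒰 ⊆ 𝒯) : IsTriplePacking S 𝒰 :=
  ⟨fun T hT => h.subset T (h' hT), fun T hT => h.card T (h' hT),
    fun T hT U hU => h.unique T (h' hT) U (h' hU)⟩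

theorem HasTriplePacking.mono {n s s' : ℕ} (h : HasTriplePacking n s) (hs : s' ≤ s) :
    HasTriplePacking n s' := by
  obtain ⟨V, S, 𝒯, h1, h2, h3⟩ := h
  exact ⟨V, S, 𝒯, h1, hs.trans h2, h3⟩

theorem HasTriplePacking.zero (n : ℕ) : HasTriplePacking n 0 :=
  ⟨Fin n, Finset.univ, ∅, by simp, by simp, by constructor <;> simp⟩

/-- Each construction uses its own convenient point set; only here is it relabelled by `Fin n` and
trimmed to exactly `s` triples. -/
theorem HasTriplePacking.exists_fin {n s : ℕ} (h : HasTriplePacking n s) :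
    ∃ 𝒯 : Finset (Finset (Fin n)), 𝒯.card = s ∧ IsTriplePacking Finset.univ 𝒯 := by
  classical
  obtain ⟨V, S, 𝒯, h1, h2, h3⟩ := h
  obtain ⟨𝒰, h𝒰, hcard⟩ := Finset.exists_subset_card_eq h2
  have hU := h3.mono h𝒰
  let e : S ≃ Fin n := S.equivFinOfCardEq h1
  let φ : Finset V → Finset (Fin n) := fun T => (T.subtype (· ∈ S)).map e.toEmbedding
  have hmem : ∀ T (p : Fin n), p ∈ φ T ↔ (e.symm p : V) ∈ T := by
    intro T p
    simp only [φ, Finset.mem_map_equiv, Finset.mem_subtype]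
  have hinj : Set.InjOn φ 𝒰 := by
    intro T hT U hU' hTU
    ext v
    constructor
    · intro hv
      have : e ⟨v, hU.subset T hT hv⟩ ∈ φ T := by rw [hmem]; simpa
      rw [hTU, hmem] at this
      simpa using this
    · intro hv
      have : e ⟨v, hU.subset U hU' hv⟩ ∈ φ U := by rw [hmem]; simpa
      rw [← hTU, hmem] at this
      simpa using this
  refine ⟨𝒰.image φ, by rw [Finset.card_image_of_injOn hinj, hcard], ?_, ?_, ?_⟩
  · intro T _; exact Finset.subset_univ _
  · intro T' hT'
    obtain ⟨T, hT, rfl⟩ := Finset.mem_image.1 hT'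
    rw [Finset.card_map, Finset.card_subtype, Finset.filter_true_of_mem (hU.subset T hT)]
    exact hU.card T hT
  · intro T' hT' U' hU' p q hpq h1 h2 h3 h4
    obtain ⟨T, hT, rfl⟩ := Finset.mem_image.1 hT'
    obtain ⟨U, hUm, rfl⟩ := Finset.mem_image.1 hU'
    rw [hmem] at h1 h2 h3 h4
    rw [hU.unique T hT U hUm _ _ ?_ h1 h2 h3 h4]
    intro h
    exact hpq (e.symm.injective (Subtype.ext h))

/-- Deleting a point of small degree. -/
theorem HasTriplePacking.pred {n s d : ℕ} (h : HasTriplePacking (n + 1) s)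
    (hd : 3 * s < (n + 1) * (d + 1)) : HasTriplePacking n (s - d) := by
  classical
  obtain ⟨V, S, 𝒯₀, h1, h2, h3⟩ := h
  obtain ⟨𝒯, h𝒯, hcard⟩ := Finset.exists_subset_card_eq h2
  have hT := h3.mono h𝒯
  have hsum : ∑ p ∈ S, (𝒯.filter (p ∈ ·)).card = 3 * s := by
    have := Finset.sum_card_bipartiteAbove_eq_sum_card_bipartiteBelow
      (s := S) (t := 𝒯) (fun (p : V) (T : Finset V) => p ∈ T)
    simp only [Finset.bipartiteAbove, Finset.bipartiteBelow] at this
    rw [this, Finset.sum_congr rfl (g := fun _ => 3)]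
    · simp [hcard, mul_comm]
    · intro T hT'
      rw [← hT.card T hT']
      congr 1
      ext p
      simpa using fun hp => hT.subset T hT' hp
  -- Averaging: the degrees of the n + 1 points sum to 3s, so some point lies in at most d triples.
  obtain ⟨p, hp, hlt⟩ : ∃ p ∈ S, (𝒯.filter (p ∈ ·)).card < d + 1 := by
    apply Finset.exists_lt_of_sum_lt
    rw [hsum]
    simpa [h1] using hd
  refine ⟨V, S.erase p, 𝒯.filter (p ∉ ·), by rw [Finset.card_erase_of_mem hp, h1]; rfl, ?_, ?_⟩
  · have := Finset.card_filter_add_card_filter_not (s := 𝒯) (p ∈ ·)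
    omega
  · refine ⟨?_, (hT.mono (Finset.filter_subset _ _)).card, (hT.mono (Finset.filter_subset _ _)).unique⟩
    intro T hT' q hq
    rw [Finset.mem_filter] at hT'
    rw [Finset.mem_erase]
    refine ⟨?_, hT.subset T hT'.1 hq⟩
    rintro rfl
    exact hT'.2 hq

/-- Triples from which the index can be read off at each pair of their points form a packing. -/
theorem IsTriplePacking.of_index {V ι : Type} [DecidableEq V] [Fintype V] (I : Finset ι)
    (T : ι → Finset V) (F : V → V → ι) (hT : ∀ i ∈ I, (T i).card = 3)
    (hF : ∀ i ∈ I, ∀ p ∈ T i, ∀ q ∈ T i, p ≠ q → F p q = i) :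
    IsTriplePacking Finset.univ (I.image T) ∧ (I.image T).card = I.card := by
  refine ⟨⟨fun _ _ => Finset.subset_univ _, ?_, ?_⟩, ?_⟩
  · intro U hU
    obtain ⟨i, hi, rfl⟩ := Finset.mem_image.1 hU
    exact hT i hi
  · intro U hU W hW p q hpq h1 h2 h3 h4
    obtain ⟨i, hi, rfl⟩ := Finset.mem_image.1 hU
    obtain ⟨j, hj, rfl⟩ := Finset.mem_image.1 hW
    rw [← hF i hi p h1 q h2 hpq, hF j hj p h3 q h4 hpq]
  · apply Finset.card_image_of_injOn
    intro i hi j hj hij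
    obtain ⟨p, hp, q, hq, hpq⟩ := Finset.one_lt_card.1 (by rw [hT i hi]; norm_num : 1 < (T i).card)
    rw [← hF i hi p hp q hq hpq, hF j hj p (hij ▸ hp) q (hij ▸ hq) hpq]

/-- Two packings covering different kinds of pairs can be joined. -/
theorem IsTriplePacking.union {V : Type} [DecidableEq V] {S : Finset V} {𝒯 𝒰 : Finset (Finset V)}
    (D : V → V → Prop) (hT : IsTriplePacking S 𝒯) (hU : IsTriplePacking S 𝒰)
    (h1 : ∀ T ∈ 𝒯, ∀ p ∈ T, ∀ q ∈ T, p ≠ q → ¬ D p q)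
    (h2 : ∀ T ∈ 𝒰, ∀ p ∈ T, ∀ q ∈ T, p ≠ q → D p q) :
    IsTriplePacking S (𝒯 ∪ 𝒰) ∧ (𝒯 ∪ 𝒰).card = 𝒯.card + 𝒰.card := by
  refine ⟨⟨?_, ?_, ?_⟩, ?_⟩
  · intro T h
    rcases Finset.mem_union.1 h with h | h
    exacts [hT.subset T h, hU.subset T h]
  · intro T h
    rcases Finset.mem_union.1 h with h | h
    exacts [hT.card T h, hU.card T h]
  · intro T h T' h' p q hpq a b c d
    rcases Finset.mem_union.1 h with h | h <;> rcases Finset.mem_union.1 h' with h' | h'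
    · exact hT.unique T h T' h' p q hpq a b c d
    · exact absurd (h2 T' h' p c q d hpq) (h1 T h p a q b hpq)
    · exact absurd (h2 T h p a q b hpq) (h1 T' h' p c q d hpq)
    · exact hU.unique T h T' h' p q hpq a b c d
  · apply Finset.card_union_of_disjoint
    rw [Finset.disjoint_left]
    intro T h h'
    obtain ⟨p, hp, q, hq, hpq⟩ := Finset.one_lt_card.1 (by rw [hT.card T h]; norm_num : 1 < T.card)
    exact h1 T h p hp q hq hpq (h2 T h' p hp q hq hpq)

/-! ### The scheme on three cyclic levels common to all constructions. -/

section Mixed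

variable {m : ℕ} [NeZero m] {I : Type} [DecidableEq I]

/-- The points of a construction on three copies of `ZMod m` with extra points `I`. -/
abbrev LevelPoint (m : ℕ) (I : Type) : Type := (ZMod m × ZMod 3) ⊕ I

/-- The triple with two points on level `i` and the third on level `i + 1`. -/
def mixedTriple (I : Type) [DecidableEq I] (σ : ZMod 3 → Equiv.Perm (ZMod m))
    (a : ZMod 3 × Sym2 (ZMod m)) : Finset (LevelPoint m I) :=
  Sym2.lift ⟨fun x y => {Sum.inl (x, a.1), Sum.inl (y, a.1), Sum.inl (σ a.1 (x + y), a.1 + 1)},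
    fun x y => by simp only [add_comm x y]; rw [Finset.insert_comm]⟩ a.2

/-- The pairs not covered by the triples `mixedTriple`. -/
def DiagonalPair (σ : ZMod 3 → Equiv.Perm (ZMod m)) : LevelPoint m I → LevelPoint m I → Prop
  | Sum.inl (x, i), Sum.inl (y, j) =>
    -- A mixed triple through such a pair would need its two points on the lower level to coincide.
    (j = i + 1 ∧ y = σ i (x + x)) ∨ (i = j + 1 ∧ x = σ j (y + y))
  | _, _ => True

/-- The mixed triple through two points. -/
def mixedIndex (σ : ZMod 3 → Equiv.Perm (ZMod m)) :
    LevelPoint m I → LevelPoint m I → ZMod 3 × Sym2 (ZMod m)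
  | Sum.inl (x, i), Sum.inl (y, j) =>
    if j = i then (i, s(x, y)) else
      -- Solving y = σ_i(x + z) for z recovers the other point on the lower level.
      if j = i + 1 then (i, s(x, (σ i).symm y - x)) else (j, s(y, (σ j).symm x - y))
  -- Dummy value: no mixed triple contains an extra point.
  | _, _ => (0, s(0, 0))

theorem zmod_three_add_one_ne (i : ZMod 3) : i + 1 ≠ i := by revert i; decide
theorem zmod_three_add_one_add_one_ne (i : ZMod 3) : i + 1 + 1 ≠ i := by revert i; decide

/-- The index set of the mixed triples. -/
def mixedIndices (m : ℕ) [NeZero m] : Finset (ZMod 3 × Sym2 (ZMod m)) :=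
  Finset.univ ×ˢ Finset.univ.filter (fun e => ¬ e.IsDiag)

theorem card_mixedIndices : (mixedIndices m).card = 3 * m.choose 2 := by
  rw [mixedIndices, Finset.card_product, ← Fintype.card_subtype, Sym2.card_subtype_not_diag]
  simp [ZMod.card]

theorem isTriplePacking_mixedTriple (I : Type) [DecidableEq I] [Fintype I]
    (σ : ZMod 3 → Equiv.Perm (ZMod m)) :
    IsTriplePacking Finset.univ ((mixedIndices m).image (mixedTriple I σ)) ∧
      ((mixedIndices m).image (mixedTriple I σ)).card = (mixedIndices m).card := by
  apply IsTriplePacking.of_index _ _ (mixedIndex σ)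
  · rintro ⟨i, e⟩ h
    induction e with | _ x y
    have hxy : x ≠ y := by simpa [mixedIndices] using h
    have := zmod_three_add_one_ne i
    simp only [mixedTriple, Sym2.lift_mk]
    rw [Finset.card_eq_three]
    exact ⟨_, _, _, by simpa using hxy, by simp [this.symm], by simp [this.symm], rfl⟩
  · rintro ⟨i, e⟩ h
    induction e with | _ x y
    have hxy : x ≠ y := by simpa [mixedIndices] using h
    have h1 := zmod_three_add_one_ne i
    have h2 := zmod_three_add_one_add_one_ne i
    simp only [mixedTriple, Sym2.lift_mk, Finset.mem_insert, Finset.mem_singleton]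
    rintro p (rfl | rfl | rfl) q (rfl | rfl | rfl) hpq <;>
      simp_all [mixedIndex, Sym2.eq_swap, h1.symm, h2.symm]

theorem not_diagonalPair_of_mixedTriple (σ : ZMod 3 → Equiv.Perm (ZMod m)) :
    ∀ T ∈ (mixedIndices m).image (mixedTriple I σ), ∀ p ∈ T, ∀ q ∈ T, p ≠ q →
      ¬ DiagonalPair σ p q := by
  intro T hT
  obtain ⟨⟨i, e⟩, h, rfl⟩ := Finset.mem_image.1 hT
  induction e with | _ x y
  have hxy : x ≠ y := by simpa [mixedIndices] using h
  have h1 := zmod_three_add_one_ne i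
  have h2 := zmod_three_add_one_add_one_ne i
  simp only [mixedTriple, Sym2.lift_mk, Finset.mem_insert, Finset.mem_singleton]
  rintro p (rfl | rfl | rfl) q (rfl | rfl | rfl) hpq <;>
    simp_all [DiagonalPair, h1.symm, h2.symm, hxy.symm]

/-- Mixed triples together with a packing of the diagonal pairs. -/
theorem HasTriplePacking.of_diagonal [Fintype I] {ι : Type} (σ : ZMod 3 → Equiv.Perm (ZMod m)) (J : Finset ι)
    (T : ι → Finset (LevelPoint m I)) (F : LevelPoint m I → LevelPoint m I → ι)
    (hT : ∀ i ∈ J, (T i).card = 3)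
    (hF : ∀ i ∈ J, ∀ p ∈ T i, ∀ q ∈ T i, p ≠ q → F p q = i ∧ DiagonalPair σ p q) :
    HasTriplePacking (3 * m + Fintype.card I) (3 * m.choose 2 + J.card) := by
  obtain ⟨h1, h2⟩ := isTriplePacking_mixedTriple I σ
  obtain ⟨h3, h4⟩ := IsTriplePacking.of_index J T F hT
    fun i hi p hp q hq hpq => (hF i hi p hp q hq hpq).1
  obtain ⟨h5, h6⟩ := h1.union (DiagonalPair σ) h3 (not_diagonalPair_of_mixedTriple σ) (by
    intro U hU
    obtain ⟨i, hi, rfl⟩ := Finset.mem_image.1 hU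
    exact fun p hp q hq hpq => (hF i hi p hp q hq hpq).2)
  refine ⟨_, _, _, ?_, ?_, h5⟩
  · simp [ZMod.card, mul_comm]
  · rw [h6, h2, h4, card_mixedIndices]

end Mixed

/-! ### The Bose construction, order 3 mod 6. -/

theorem card_triple_of_ne {α : Type} [DecidableEq α] {x y z : α} (h1 : x ≠ y) (h2 : x ≠ z)
    (h3 : y ≠ z) : ({x, y, z} : Finset α).card = 3 :=
  Finset.card_eq_three.2 ⟨x, y, z, h1, h2, h3, rfl⟩

/-- Halving modulo an odd number. -/
def halfPerm (k : ℕ) : Equiv.Perm (ZMod (2 * k + 1)) where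
  toFun z := z * (k + 1)
  invFun z := z + z
  left_inv z := by
    have h : ((2 * k + 1 : ℕ) : ZMod (2 * k + 1)) = 0 := ZMod.natCast_self _
    push_cast at h
    linear_combination z * h
  right_inv z := by
    have h : ((2 * k + 1 : ℕ) : ZMod (2 * k + 1)) = 0 := ZMod.natCast_self _
    push_cast at h
    linear_combination z * h

theorem halfPerm_add_self (k : ℕ) (x : ZMod (2 * k + 1)) : halfPerm k (x + x) = x :=
  (halfPerm k).right_inv x

/-- With σ the halving map, a diagonal pair joins points of equal first coordinate, so the diagonal
pairs split into vertical triangles, one for each x. -/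
theorem hasTriplePacking_bose (k : ℕ) :
    HasTriplePacking (6 * k + 3) (3 * (2 * k + 1).choose 2 + (2 * k + 1)) := by
  have := HasTriplePacking.of_diagonal (m := 2 * k + 1) (I := Empty) (fun _ => halfPerm k)
    (Finset.univ : Finset (ZMod (2 * k + 1)))
    (fun x => {Sum.inl (x, 0), Sum.inl (x, 1), Sum.inl (x, 2)})
    (fun p _ => p.elim Prod.fst (fun e => e.elim))
    (fun x _ => by
      apply card_triple_of_ne <;> simp only [ne_eq, Sum.inl.injEq, Prod.mk.injEq, true_and] <;>
        decide)
    (fun x _ p hp q hq hpq => by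
      simp only [Finset.mem_insert, Finset.mem_singleton] at hp hq
      rcases hp with rfl | rfl | rfl <;> rcases hq with rfl | rfl | rfl <;>
        first
        | exact absurd rfl hpq
        | (refine ⟨rfl, ?_⟩
           simp only [DiagonalPair, halfPerm_add_self, and_true]
           decide))
  simp only [Fintype.card_empty, Finset.card_univ, ZMod.card] at this
  exact (show 3 * (2 * k + 1) + 0 = 6 * k + 3 by ring) ▸ this

/-! ### The Skolem construction, order 1 mod 6. -/

section Skolem

theorem half_add_half {k : ℕ} (x : ZMod (2 * k)) : (x + k) + (x + k) = x + x := by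
  have h : ((2 * k : ℕ) : ZMod (2 * k)) = 0 := ZMod.natCast_self _
  push_cast at h
  linear_combination h

variable (k : ℕ) [NeZero k]

/-- The map sending `2 x` to `x` and `2 x + 1` to `k + x` for `x < k`. -/
def skolemMap (z : ZMod (2 * k)) : ZMod (2 * k) :=
  if z.val % 2 = 0 then ((z.val / 2 : ℕ) : ZMod (2 * k)) else ((k + z.val / 2 : ℕ) : ZMod (2 * k))

theorem val_skolemMap (z : ZMod (2 * k)) :
    (skolemMap k z).val = if z.val % 2 = 0 then z.val / 2 else k + z.val / 2 := by
  have := ZMod.val_lt z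
  unfold skolemMap
  split_ifs <;> exact ZMod.val_cast_of_lt (by omega)

theorem skolemMap_injective : Function.Injective (skolemMap k) := by
  intro a b h
  have h' := congrArg ZMod.val h
  rw [val_skolemMap, val_skolemMap] at h'
  have h1 := ZMod.val_lt a
  have h2 := ZMod.val_lt b
  apply ZMod.val_injective
  split_ifs at h' <;> omega

/-- `skolemMap` as a permutation. -/
noncomputable def skolemPerm : Equiv.Perm (ZMod (2 * k)) :=
  Equiv.ofBijective (skolemMap k) (Finite.injective_iff_bijective.1 (skolemMap_injective k))

variable {k}

theorem skolemPerm_add_self {x : ZMod (2 * k)} (hx : x.val < k) : skolemPerm k (x + x) = x := by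
  apply ZMod.val_injective
  change (skolemMap k (x + x)).val = _
  have h : (x + x).val = x.val + x.val := by rw [ZMod.val_add, Nat.mod_eq_of_lt (by omega)]
  rw [val_skolemMap, h, if_pos (by omega)]
  omega

theorem val_add_half {x : ZMod (2 * k)} (hx : x.val < k) : (x + k).val = x.val + k := by
  have hk := NeZero.pos k
  rw [ZMod.val_add, ZMod.val_cast_of_lt (by omega), Nat.mod_eq_of_lt (by omega)]

theorem add_half_ne (x : ZMod (2 * k)) : x + k ≠ x := by
  have hk := NeZero.pos k
  intro h
  have h' := congrArg ZMod.val (add_eq_left.1 h)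
  rw [ZMod.val_cast_of_lt (by omega), ZMod.val_zero] at h'
  omega

theorem card_val_lt : (Finset.univ.filter (fun x : ZMod (2 * k) => x.val < k)).card = k := by
  have hk := NeZero.pos k
  refine Eq.trans ?_ (Finset.card_range k)
  refine Finset.card_bij (fun x _ => x.val) ?_ ?_ ?_
  · intro x hx
    simpa using hx
  · intro x _ y _ h
    exact ZMod.val_injective _ h
  · intro v hv
    rw [Finset.mem_range] at hv
    have := ZMod.val_cast_of_lt (n := 2 * k) (a := v) (by omega)
    exact ⟨(v : ZMod (2 * k)), by simp [this, hv], this⟩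

/-- The diagonal triples of the Skolem construction. -/
def skolemTriple (a : ZMod (2 * k) × Option (ZMod 3)) : Finset (LevelPoint (2 * k) Unit) :=
  match a with
  | (x, none) => {Sum.inl (x, 0), Sum.inl (x, 1), Sum.inl (x, 2)}
  | (x, some i) => {Sum.inr (), Sum.inl (x + k, i), Sum.inl (x, i + 1)}

/-- The index of the triple `skolemTriple` through two points. -/
def skolemIndex : LevelPoint (2 * k) Unit → LevelPoint (2 * k) Unit →
    ZMod (2 * k) × Option (ZMod 3)
  | Sum.inl (x, i), Sum.inl (y, j) =>
    if x = y then (x, none) else if x.val < k then (x, some j) else (y, some i)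
  | Sum.inl (y, j), Sum.inr _ => if y.val < k then (y, some (j - 1)) else (y - k, some j)
  | Sum.inr _, Sum.inl (y, j) => if y.val < k then (y, some (j - 1)) else (y - k, some j)
  | Sum.inr _, Sum.inr _ => (0, none)

/-- Modulo 2k, both x and x + k double to 2x, and σ sends 2x back to x when x < k. The diagonal
pairs on levels are therefore a vertical triangle for each x < k and the disjoint pairs (x + k, i),
(x, i + 1), which are completed by the one extra point. Each x < k contributes 1 + 3 triples. -/
theorem hasTriplePacking_skolem (k : ℕ) [NeZero k] :
    HasTriplePacking (6 * k + 1) (3 * (2 * k).choose 2 + k * 4) := by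
  have := HasTriplePacking.of_diagonal (m := 2 * k) (I := Unit) (fun _ => skolemPerm k)
    (Finset.univ.filter (fun x : ZMod (2 * k) => x.val < k) ×ˢ
      (Finset.univ : Finset (Option (ZMod 3))))
    skolemTriple skolemIndex
    (by
      rintro ⟨x, _ | i⟩ -
      · apply card_triple_of_ne <;>
          simp only [ne_eq, Sum.inl.injEq, Prod.mk.injEq, true_and] <;> decide
      · have := zmod_three_add_one_ne i
        apply card_triple_of_ne <;> simp [this.symm])
    (by
      rintro ⟨x, _ | i⟩ hx p hp q hq hpq
      · have hx : x.val < k := by simpa using hx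
        simp only [skolemTriple, Finset.mem_insert, Finset.mem_singleton] at hp hq
        rcases hp with rfl | rfl | rfl <;> rcases hq with rfl | rfl | rfl <;>
          first
          | exact absurd rfl hpq
          | (refine ⟨if_pos rfl, ?_⟩
             simp only [DiagonalPair, skolemPerm_add_self hx, and_true]
             decide)
      · have hx : x.val < k := by simpa using hx
        have h1 := add_half_ne x
        have h2 := val_add_half hx
        have h3 := skolemPerm_add_self hx
        have h4 := half_add_half x
        simp only [skolemTriple, Finset.mem_insert, Finset.mem_singleton] at hp hq
        rcases hp with rfl | rfl | rfl <;> rcases hq with rfl | rfl | rfl <;>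
          first
          | exact absurd rfl hpq
          | simp [skolemIndex, DiagonalPair, hx, h1, h1.symm, h2, h3, h4])
  rw [Finset.card_product, card_val_lt] at this
  simp only [Fintype.card_unit, Finset.card_univ, Fintype.card_option, ZMod.card] at this
  exact (show 3 * (2 * k) + 1 = 6 * k + 1 by ring) ▸ this

end Skolem

/-! ### A construction with two extra points, order 5 mod 6. -/

section FiveModSix

variable {k : ℕ}

/-- The next point along the cycles formed by the diagonal pairs. -/
def cycleSucc (p : ZMod (2 * k + 1) × ZMod 3) : ZMod (2 * k + 1) × ZMod 3 :=
  (if p.2 = 2 then -p.1 else p.1, p.2 + 1)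

/-- The previous point along the cycles formed by the diagonal pairs. -/
def cyclePred (p : ZMod (2 * k + 1) × ZMod 3) : ZMod (2 * k + 1) × ZMod 3 :=
  (if p.2 = 0 then -p.1 else p.1, p.2 - 1)

/-- A colouring alternating along the cycles formed by the diagonal pairs. -/
def cycleColor (p : ZMod (2 * k + 1) × ZMod 3) : Bool :=
  xor (decide (p.1.val ≤ k)) (decide (p.2 = 1))

theorem cyclePred_cycleSucc (p : ZMod (2 * k + 1) × ZMod 3) : cyclePred (cycleSucc p) = p := by
  obtain ⟨x, i⟩ := p
  have : i + 1 = 0 ↔ i = 2 := by revert i; decide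
  simp only [cyclePred, cycleSucc, this, add_sub_cancel_right]
  split_ifs <;> simp

/-- Between levels 0, 1 and 2 the test for level 1 flips the colour. From level 2 to level 0 the
sign change does, since exactly one of x and -x has representative at most k when x is nonzero. -/
theorem cycleColor_cycleSucc {p : ZMod (2 * k + 1) × ZMod 3} (hp : p ≠ (0, 2)) :
    cycleColor (cycleSucc p) ≠ cycleColor p := by
  obtain ⟨x, i⟩ := p
  obtain rfl | rfl | rfl : i = 0 ∨ i = 1 ∨ i = 2 :=
    (by decide : ∀ i : ZMod 3, i = 0 ∨ i = 1 ∨ i = 2) i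
  · have h1 : (0 : ZMod 3) ≠ 2 := by decide
    have h2 : (0 : ZMod 3) ≠ 1 := by decide
    simp [cycleColor, cycleSucc, h1, h2]
  · have h1 : (1 : ZMod 3) ≠ 2 := by decide
    have h2 : (1 + 1 : ZMod 3) ≠ 1 := by decide
    simp [cycleColor, cycleSucc, h1, h2]
  · have h1 : (2 : ZMod 3) ≠ 1 := by decide
    have h2 : (2 + 1 : ZMod 3) ≠ 1 := by decide
    have hx : x ≠ 0 := by rintro rfl; exact hp rfl
    have : NeZero x := ⟨hx⟩
    have hneg := ZMod.val_neg_of_ne_zero x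
    have hlt := ZMod.val_lt x
    simp only [cycleColor, cycleSucc, h1, h2, if_true, decide_false, Bool.xor_false, ne_eq,
      decide_eq_decide, hneg]
    omega

theorem cycleSucc_cycleSucc_ne (p : ZMod (2 * k + 1) × ZMod 3) : cycleSucc (cycleSucc p) ≠ p :=
  fun h => zmod_three_add_one_add_one_ne p.2 (congrArg Prod.snd h)

theorem cycleSucc_ne (p : ZMod (2 * k + 1) × ZMod 3) : cycleSucc p ≠ p :=
  fun h => zmod_three_add_one_ne p.2 (congrArg Prod.snd h)

/-- Halving, with a sign change between the last and the first level. -/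
def signedHalfPerm (k : ℕ) (i : ZMod 3) : Equiv.Perm (ZMod (2 * k + 1)) :=
  if i = 2 then (halfPerm k).trans (Equiv.neg _) else halfPerm k

theorem signedHalfPerm_add_self (p : ZMod (2 * k + 1) × ZMod 3) :
    signedHalfPerm k p.2 (p.1 + p.1) = (cycleSucc p).1 := by
  unfold signedHalfPerm cycleSucc
  split_ifs <;> simp [halfPerm_add_self]

/-- The triple consisting of a diagonal pair and one of the two extra points. -/
def cycleTriple (p : ZMod (2 * k + 1) × ZMod 3) : Finset (LevelPoint (2 * k + 1) Bool) :=
  {Sum.inr (cycleColor p), Sum.inl p, Sum.inl (cycleSucc p)}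

/-- The index of the triple `cycleTriple` through two points. -/
def cycleIndex : LevelPoint (2 * k + 1) Bool → LevelPoint (2 * k + 1) Bool →
    ZMod (2 * k + 1) × ZMod 3
  | Sum.inl p, Sum.inl q => if q = cycleSucc p then p else q
  | Sum.inl q, Sum.inr b => if cycleColor q = b then q else cyclePred q
  | Sum.inr b, Sum.inl q => if cycleColor q = b then q else cyclePred q
  | Sum.inr _, Sum.inr _ => (0, 0)

theorem diagonalPair_cycleSucc (p : ZMod (2 * k + 1) × ZMod 3) :
    DiagonalPair (I := Bool) (signedHalfPerm k) (Sum.inl p) (Sum.inl (cycleSucc p)) :=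
  Or.inl ⟨rfl, (signedHalfPerm_add_self p).symm⟩

theorem diagonalPair_cycleSucc_symm (p : ZMod (2 * k + 1) × ZMod 3) :
    DiagonalPair (I := Bool) (signedHalfPerm k) (Sum.inl (cycleSucc p)) (Sum.inl p) :=
  Or.inr ⟨rfl, (signedHalfPerm_add_self p).symm⟩

/-- The sign change arranges the diagonal pairs on levels into hexagons through x and -x, plus one
triangle at x = 0. Colouring the pairs alternately along each hexagon assigns them to the two extra
points; the triangle is odd, so its pair starting at (0, 2) is dropped. -/
theorem hasTriplePacking_five_mod_six (k : ℕ) :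
    HasTriplePacking (6 * k + 5) (3 * (2 * k + 1).choose 2 + (6 * k + 2)) := by
  have := HasTriplePacking.of_diagonal (m := 2 * k + 1) (I := Bool) (signedHalfPerm k)
    ((Finset.univ : Finset (ZMod (2 * k + 1) × ZMod 3)).erase (0, 2))
    cycleTriple cycleIndex
    (fun p _ => card_triple_of_ne (by simp) (by simp) (by simpa using (cycleSucc_ne p).symm))
    (by
      intro a ha p hp q hq hpq
      have h1 := cycleColor_cycleSucc (Finset.ne_of_mem_erase ha)
      have h2 := cycleSucc_cycleSucc_ne a
      have h3 := cyclePred_cycleSucc a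
      have h4 := diagonalPair_cycleSucc a
      have h5 := diagonalPair_cycleSucc_symm a
      simp only [cycleTriple, Finset.mem_insert, Finset.mem_singleton] at hp hq
      rcases hp with rfl | rfl | rfl <;> rcases hq with rfl | rfl | rfl <;>
        first
        | exact absurd rfl hpq
        | exact ⟨by simp [cycleIndex, h1, h3], trivial⟩
        | exact ⟨by simp [cycleIndex, h2.symm], by assumption⟩)
  rw [Finset.card_erase_of_mem (Finset.mem_univ _)] at this
  simp only [Fintype.card_bool, Finset.card_univ, Fintype.card_prod, ZMod.card] at this
  have e1 : (2 * k + 1) * 3 - 1 = 6 * k + 2 := by omega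
  have e2 : 3 * (2 * k + 1) + 2 = 6 * k + 5 := by ring
  rwa [e1, e2] at this

end FiveModSix

/-! ### Packings of the required size for every order. -/

theorem two_mul_choose_two (n : ℕ) : 2 * (n + 1).choose 2 = (n + 1) * n := by
  rw [Nat.choose_two_right, Nat.add_sub_cancel]
  exact Nat.mul_div_cancel' (by simpa [mul_comm] using (Nat.even_mul_succ_self n).two_dvd)

/-- Triple packings as large as needed exist on any number of points. -/
theorem hasTriplePacking_of_le (n s : ℕ) (h : 6 * s ≤ n ^ 2) : HasTriplePacking (n + 1) s := by
  have hodd : ∀ k, (2 * k + 1).choose 2 = (2 * k + 1) * k := fun k => by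
    have := two_mul_choose_two (2 * k)
    nlinarith
  obtain ⟨k, hk | hk | hk | hk | hk | hk⟩ : ∃ k, n = 6 * k ∨ n = 6 * k + 1 ∨ n = 6 * k + 2 ∨
      n = 6 * k + 3 ∨ n = 6 * k + 4 ∨ n = 6 * k + 5 := ⟨n / 6, by omega⟩
  -- The Skolem construction needs k ≥ 1; a single point only has to carry the empty packing.
  · rcases Nat.eq_zero_or_pos k with rfl | hpos
    · obtain rfl : s = 0 := by subst hk; omega
      exact HasTriplePacking.zero _
    · have : NeZero k := ⟨hpos.ne'⟩
      subst hk
      refine (hasTriplePacking_skolem k).mono ?_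
      obtain ⟨j, rfl⟩ : ∃ j, k = j + 1 := ⟨k - 1, by omega⟩
      have := two_mul_choose_two (2 * j + 1)
      rw [show 2 * j + 1 + 1 = 2 * (j + 1) by ring] at this
      nlinarith
  · subst hk
    have h1 := hasTriplePacking_bose k
    rw [hodd] at h1
    -- Every point of the Bose system lies in 3k + 1 triples. Deleting one leaves 6k² + 2k triples,
    -- exactly the integer part of n²/6, so the estimate has to use integrality.
    refine (h1.pred (d := 3 * k + 1) (by nlinarith)).mono ?_
    apply Nat.le_sub_of_add_le
    by_contra hc
    nlinarith
  · subst hk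
    refine (hasTriplePacking_bose k).mono ?_
    rw [hodd]
    nlinarith
  · subst hk
    have h1 := hasTriplePacking_five_mod_six k
    rw [hodd] at h1
    refine (h1.pred (d := 3 * k + 1) (by nlinarith)).mono ?_
    apply Nat.le_sub_of_add_le
    by_contra hc
    nlinarith
  · subst hk
    refine (hasTriplePacking_five_mod_six k).mono ?_
    rw [hodd]
    by_contra hc
    nlinarith
  · subst hk
    have : NeZero (k + 1) := ⟨by omega⟩
    have h1 := hasTriplePacking_skolem (k + 1)
    have h2 := two_mul_choose_two (2 * k + 1)
    rw [show 2 * k + 1 + 1 = 2 * (k + 1) by ring] at h2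
    have h3 : (2 * (k + 1)).choose 2 = (k + 1) * (2 * k + 1) := by nlinarith
    rw [h3] at h1
    refine (HasTriplePacking.pred (n := 6 * k + 5 + 1) (d := 3 * (k + 1)) h1 (by nlinarith)).mono ?_
    apply Nat.le_sub_of_add_le
    by_contra hc
    nlinarith

/-! ### The upper bound and the characterisation of equality. -/

section Extremal

variable {k n : ℕ} {G : Fin k → SimpleGraph (Fin n)}

theorem ncard_edgeSet_top (n : ℕ) : (⊤ : SimpleGraph (Fin n)).edgeSet.ncard = n.choose 2 := by
  rw [← SimpleGraph.coe_edgeFinset, Set.ncard_coe_finset,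
    SimpleGraph.card_edgeFinset_top_eq_card_choose_two, Fintype.card_fin]

theorem IsDecomposition.sum_ncard (hG : IsDecomposition G) :
    ∑ i, (G i).edgeSet.ncard = n.choose 2 := by
  rw [← ncard_edgeSet_top, ← hG.cover, Set.ncard_iUnion_of_finite (fun _ => Set.toFinite _)
    (fun i j hij => hG.disjoint i j hij), finsum_eq_sum_of_fintype]

/-- The multiset of `a` triangles, `b` single edges and `c` paths on three vertices. -/
def smallGraphs (a b c : ℕ) : Multiset Graph :=
  Multiset.replicate a (K 3) + Multiset.replicate b (K 2) + Multiset.replicate c (P 3)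

theorem map_eq_replicate_of_rel {α β γ : Type*} {r : α → β → Prop} {s : Multiset α} {m : ℕ}
    {y : β} {f : α → γ} {v : γ} (h : Multiset.Rel r s (Multiset.replicate m y))
    (hf : ∀ x, r x y → f x = v) : s.map f = Multiset.replicate m v := by
  refine Multiset.eq_replicate.2 ⟨?_, ?_⟩
  · rw [Multiset.card_map, Multiset.card_eq_card_of_rel h, Multiset.card_replicate]
  · intro w hw
    obtain ⟨x, hx, rfl⟩ := Multiset.mem_map.1 hw
    obtain ⟨z, hz, hxz⟩ := Multiset.exists_mem_of_rel_of_mem h hx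
    rw [Multiset.eq_of_mem_replicate hz] at hxz
    exact hf x hxz

/-- The matching splits the indices into three classes on which the edge number and Mad are
constant. -/
theorem FormsMultiset.sums {a b c : ℕ} (h : FormsMultiset G (smallGraphs a b c)) :
    k = a + b + c ∧ ∑ i, (G i).edgeSet.ncard = 3 * a + b + 2 * c ∧
      ∑ i, Mad (G i) = 2 * a + b + 4 / 3 * c := by
  have h' : Multiset.Rel (fun i A => Graph.Iso (supp (G i)) A)
      (Finset.univ : Finset (Fin k)).val (smallGraphs a b c) := by
    rw [FormsMultiset, ← Multiset.map_id (smallGraphs a b c), Multiset.rel_map] at h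
    exact h
  simp only [smallGraphs, Multiset.rel_add_right] at h'
  obtain ⟨s, s₁, ⟨s₃, s₂, h₃, h₂, rfl⟩, h₁, hs⟩ := h'
  have hk := congrArg Multiset.card hs
  have he := congrArg (fun u => (u.map fun i => (G i).edgeSet.ncard).sum) hs
  have hM := congrArg (fun u => (u.map fun i => Mad (G i)).sum) hs
  simp only [Multiset.map_add, Multiset.sum_add] at he hM
  rw [map_eq_replicate_of_rel h₃ fun i h => (Mad_of_iso_K_three h).2,
    map_eq_replicate_of_rel h₂ fun i h => (Mad_of_iso_K_two h).2,
    map_eq_replicate_of_rel h₁ fun i h => (Mad_of_iso_P_three h).2] at he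
  rw [map_eq_replicate_of_rel h₃ fun i h => (Mad_of_iso_K_three h).1,
    map_eq_replicate_of_rel h₂ fun i h => (Mad_of_iso_K_two h).1,
    map_eq_replicate_of_rel h₁ fun i h => (Mad_of_iso_P_three h).1] at hM
  refine ⟨?_, he.trans ?_, hM.trans ?_⟩
  · simpa [Multiset.card_eq_card_of_rel h₃, Multiset.card_eq_card_of_rel h₂,
      Multiset.card_eq_card_of_rel h₁] using hk
  · simp [mul_comm]
  · simp [mul_comm]

theorem exists_replicate_of_forall {α : Type*} {x y z : α} (s : Multiset α)
    (h : ∀ w ∈ s, w = x ∨ w = y ∨ w = z) : ∃ a b c,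
      s = Multiset.replicate a x + Multiset.replicate b y + Multiset.replicate c z := by
  induction s using Multiset.induction with
  | empty => exact ⟨0, 0, 0, by simp⟩
  | cons w s ih =>
    obtain ⟨a, b, c, rfl⟩ := ih fun v hv => h v (Multiset.mem_cons_of_mem hv)
    rcases h w (Multiset.mem_cons_self _ _) with rfl | rfl | rfl
    · exact ⟨a + 1, b, c, by simp [Multiset.replicate_succ]⟩
    · exact ⟨a, b + 1, c, by simp [Multiset.replicate_succ]⟩
    · exact ⟨a, b, c + 1, by simp [Multiset.replicate_succ]⟩

theorem exists_formsMultiset (h : ∀ i, Graph.Iso (supp (G i)) (K 3) ∨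
    Graph.Iso (supp (G i)) (K 2) ∨ Graph.Iso (supp (G i)) (P 3)) :
    ∃ a b c, FormsMultiset G (smallGraphs a b c) := by
  have h' : ∀ i, ∃ A, Graph.Iso (supp (G i)) A ∧ (A = K 3 ∨ A = K 2 ∨ A = P 3) := by
    intro i
    rcases h i with h | h | h
    exacts [⟨_, h, by simp⟩, ⟨_, h, by simp⟩, ⟨_, h, by simp⟩]
  choose A hA hA' using h'
  obtain ⟨a, b, c, habc⟩ := exists_replicate_of_forall
    ((Finset.univ : Finset (Fin k)).val.map A) (by
      intro w hw
      obtain ⟨i, -, rfl⟩ := Multiset.mem_map.1 hw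
      exact hA' i)
  refine ⟨a, b, c, ?_⟩
  rw [FormsMultiset, smallGraphs, ← habc, Multiset.rel_map]
  exact Multiset.rel_refl_of_refl_on fun i _ => hA i

/-- A decomposition either consists of copies of `K_3`, `K_2` and `P_3`, or is far from optimal. -/
theorem IsDecomposition.cases (hG : IsDecomposition G) :
    (∃ a b c, FormsMultiset G (smallGraphs a b c)) ∨
      2 * ∑ i, Mad (G i) ≤ (n.choose 2 : ℝ) + k - 1 := by
  by_cases h : ∀ i, Graph.Iso (supp (G i)) (K 3) ∨
    Graph.Iso (supp (G i)) (K 2) ∨ Graph.Iso (supp (G i)) (P 3)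
  · exact Or.inl (exists_formsMultiset h)
  right
  push Not at h
  obtain ⟨j, hj3, hj2, hjP⟩ := h
  have hj : 2 * Mad (G j) ≤ (G j).edgeSet.ncard := by
    have := ((iso_or_Mad_le (G j)).resolve_left hj3).resolve_left hj2 |>.resolve_left hjP
    linarith
  have hle : ∀ i, 2 * Mad (G i) ≤ (G i).edgeSet.ncard + 1 := by
    intro i
    rcases iso_or_Mad_le (G i) with h | h | h | h
    · obtain ⟨h1, h2⟩ := Mad_of_iso_K_three h
      rw [h1, h2]; norm_num
    · obtain ⟨h1, h2⟩ := Mad_of_iso_K_two h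
      rw [h1, h2]; norm_num
    · obtain ⟨h1, h2⟩ := Mad_of_iso_P_three h
      rw [h1, h2]; norm_num
    · linarith
  -- The exceptional member `j` loses a full unit against the bound e + 1.
  have hsum : ∑ i, 2 * Mad (G i) ≤ ∑ i, (((G i).edgeSet.ncard : ℝ) + 1 - if i = j then 1 else 0) := by
    refine Finset.sum_le_sum fun i _ => ?_
    split_ifs with hij
    · subst hij; linarith
    · linarith [hle i]
  rw [← Finset.mul_sum, Finset.sum_sub_distrib, Finset.sum_add_distrib, ← Nat.cast_sum,
    hG.sum_ncard] at hsum
  simpa using hsum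

/-- A member with e edges contributes e - 1 to t: two for a triangle, one for a path, none for an
edge. -/
theorem smallGraphs_of_sums {a b c t : ℕ} (hk : k + t = n.choose 2) (hG : IsDecomposition G)
    (h : FormsMultiset G (smallGraphs a b c)) : t = 2 * a + c ∧ n.choose 2 = 3 * a + b + 2 * c ∧
      ∑ i, Mad (G i) = 2 * a + b + 4 / 3 * c := by
  obtain ⟨h1, h2, h3⟩ := h.sums
  rw [hG.sum_ncard] at h2
  exact ⟨by omega, h2, h3⟩

/-- The optimal multisets have the parameters `a = t / 2` and `c = t % 2`. -/
theorem isUniqueExtremal_of_exists {t : ℕ} (hk : k + t = n.choose 2)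
    (hex : ∃ x ∈ madSums k n,
      (n.choose 2 : ℝ) - ((t / 2 : ℕ) : ℝ) - 2 / 3 * ((t % 2 : ℕ) : ℝ) ≤ x) :
    M k n = (n.choose 2 : ℝ) - ((t / 2 : ℕ) : ℝ) - 2 / 3 * ((t % 2 : ℕ) : ℝ) ∧
      IsUniqueExtremal k n
        (smallGraphs (t / 2) (n.choose 2 - 2 * (t % 2) - 3 * (t / 2)) (t % 2)) := by
  set N : ℝ := (n.choose 2 : ℝ) - ((t / 2 : ℕ) : ℝ) - 2 / 3 * ((t % 2 : ℕ) : ℝ) with hN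
  have hkt : (k : ℝ) + t = n.choose 2 := by exact_mod_cast hk
  have hdm : (t : ℝ) = 2 * ((t / 2 : ℕ) : ℝ) + ((t % 2 : ℕ) : ℝ) := by
    exact_mod_cast (Nat.div_add_mod t 2).symm
  have hmod : ((t % 2 : ℕ) : ℝ) ≤ 1 := by exact_mod_cast (by omega : t % 2 ≤ 1)
  have key : ∀ G : Fin k → SimpleGraph (Fin n), IsDecomposition G → ∑ i, Mad (G i) ≤ N ∧
      (∑ i, Mad (G i) = N ↔ FormsMultiset G
        (smallGraphs (t / 2) (n.choose 2 - 2 * (t % 2) - 3 * (t / 2)) (t % 2))) := by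
    intro G hG
    have hback : FormsMultiset G
        (smallGraphs (t / 2) (n.choose 2 - 2 * (t % 2) - 3 * (t / 2)) (t % 2)) →
        ∑ i, Mad (G i) = N := by
      intro h
      obtain ⟨-, h2, h3⟩ := smallGraphs_of_sums hk hG h
      have h2' := congrArg (Nat.cast (R := ℝ)) h2
      push_cast at h2' h3
      rw [h3, hN]
      linarith
    rcases hG.cases with ⟨a, b, c, h⟩ | h
    · obtain ⟨h1, h2, h3⟩ := smallGraphs_of_sums hk hG h
      have h1' : (t : ℝ) = 2 * a + c := by exact_mod_cast h1
      have h2' : (n.choose 2 : ℝ) = 3 * a + b + 2 * c := by exact_mod_cast h2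
      -- Here the total is C(n,2) - t/2 - c/6 with c ≡ t mod 2, so it is largest exactly when c = t
      -- mod 2.
      have hc : t % 2 ≤ c := by omega
      have hc' : ((t % 2 : ℕ) : ℝ) ≤ c := by exact_mod_cast hc
      refine ⟨by rw [h3]; linarith, fun hs => ?_, hback⟩
      have hc0 : (c : ℝ) = ((t % 2 : ℕ) : ℝ) := by linarith
      have hc1 : c = t % 2 := by exact_mod_cast hc0
      have ha : a = t / 2 := by omega
      have hb : b = n.choose 2 - 2 * (t % 2) - 3 * (t / 2) := by omega
      rwa [← hc1, ← ha, ← show b = n.choose 2 - 2 * c - 3 * a by omega]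
    -- The total is at most C(n,2) - (t+1)/2, which `N` exceeds by 1/2 for even t and by 1/3 for odd
    -- t.
    · have hlt : ∑ i, Mad (G i) < N := by linarith
      exact ⟨hlt.le, fun hs => absurd hs hlt.ne, hback⟩
  have hgreat : IsGreatest (madSums k n) N := by
    refine ⟨?_, ?_⟩
    · obtain ⟨x, ⟨G, hG, rfl⟩, hx⟩ := hex
      exact ⟨G, hG, le_antisymm hx (key G hG).1⟩
    · rintro x ⟨G, hG, rfl⟩
      exact (key G hG).1
  have hM : M k n = N := hgreat.csSup_eq
  refine ⟨hM, ?_, ?_⟩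
  · rw [hM]; exact hgreat
  · intro G hG
    rw [hM]
    exact (key G hG).2

end Extremal

/-! ### Decompositions attaining the bound. -/

section Existence

variable {n : ℕ}

/-- Edge-disjoint graphs are completed to a decomposition by single edges. -/
theorem exists_decomposition {ι : Type} [Fintype ι] (H : ι → SimpleGraph (Fin n)) (k : ℕ)
    (hdisj : ∀ i j, i ≠ j → Disjoint (H i).edgeSet (H j).edgeSet)
    (hk : k + ∑ i, (H i).edgeSet.ncard = n.choose 2 + Fintype.card ι) :
    ∃ x ∈ madSums k n,
      x = ∑ i, Mad (H i) + ((n.choose 2 : ℝ) - ∑ i, ((H i).edgeSet.ncard : ℝ)) := by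
  classical
  let L : Finset (Sym2 (Fin n)) :=
    (⊤ : SimpleGraph (Fin n)).edgeFinset \ Finset.univ.biUnion fun i => (H i).edgeFinset
  have hL : L.card + ∑ i, (H i).edgeSet.ncard = n.choose 2 := by
    have h1 : (Finset.univ.biUnion fun i => (H i).edgeFinset).card =
        ∑ i, (H i).edgeSet.ncard := by
      rw [Finset.card_biUnion]
      · refine Finset.sum_congr rfl fun i _ => ?_
        rw [← Set.ncard_coe_finset, SimpleGraph.coe_edgeFinset]
      · intro i _ j _ hij
        rw [Function.onFun, ← Finset.disjoint_coe, SimpleGraph.coe_edgeFinset, SimpleGraph.coe_edgeFinset]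
        exact hdisj i j hij
    have h2 := Finset.card_sdiff_add_card_eq_card
      (s := Finset.univ.biUnion fun i => (H i).edgeFinset)
      (t := (⊤ : SimpleGraph (Fin n)).edgeFinset) (by
        intro e he
        obtain ⟨i, -, he⟩ := Finset.mem_biUnion.1 he
        exact SimpleGraph.edgeFinset_mono le_top he)
    rw [h1, SimpleGraph.card_edgeFinset_top_eq_card_choose_two, Fintype.card_fin] at h2
    exact h2
  have hLmem : ∀ e ∈ L, ¬ e.IsDiag ∧ ∀ i, e ∉ (H i).edgeSet := by
    intro e he
    simp only [L, Finset.mem_sdiff, SimpleGraph.mem_edgeFinset, SimpleGraph.edgeSet_top,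
      Finset.mem_biUnion, Finset.mem_univ, true_and, not_exists] at he
    exact ⟨by simpa using he.1, he.2⟩
  let F : ι ⊕ L → SimpleGraph (Fin n) := Sum.elim H fun e => SimpleGraph.fromEdgeSet {e.1}
  have hF : ∀ e : L, (F (Sum.inr e)).edgeSet = {e.1} := by
    intro e
    simp only [F, Sum.elim_inr, SimpleGraph.edgeSet_fromEdgeSet]
    rw [sdiff_eq_left, Set.disjoint_singleton_left]
    exact (hLmem e.1 e.2).1
  have hMad : ∀ e : L, Mad (F (Sum.inr e)) = 1 := by
    intro e
    obtain ⟨a, b, hab, h⟩ := exists_edge_of_ncard_eq_one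
      (G := F (Sum.inr e)) (by rw [hF, Set.ncard_singleton])
    exact (Mad_of_iso_K_two (iso_K_two_of_edgeSet hab h)).1
  -- `hk` says precisely that the given graphs and the leftover single edges together number k.
  have hcard : Fintype.card (ι ⊕ L) = k := by
    rw [Fintype.card_sum, Fintype.card_coe]
    omega
  let e : Fin k ≃ ι ⊕ L := (Fintype.equivFinOfCardEq hcard).symm
  have hFdisj : ∀ i j, i ≠ j → Disjoint (F i).edgeSet (F j).edgeSet := by
    rintro (i | i) (j | j) hij
    · exact hdisj i j fun h => hij (h ▸ rfl)
    · rw [hF, Set.disjoint_singleton_right]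
      exact (hLmem j.1 j.2).2 i
    · rw [hF, Set.disjoint_singleton_left]
      exact (hLmem i.1 i.2).2 j
    · rw [hF, hF, Set.disjoint_singleton]
      exact fun h => hij (congrArg Sum.inr (Subtype.ext h))
  refine ⟨_, ⟨fun i => F (e i), ⟨?_, ?_⟩, rfl⟩, ?_⟩
  · exact fun i j hij => hFdisj _ _ fun h => hij (e.injective h)
  · refine Set.Subset.antisymm (Set.iUnion_subset fun i => SimpleGraph.edgeSet_mono le_top) ?_
    intro d hd
    rw [Set.mem_iUnion]
    by_cases h : ∃ i, d ∈ (H i).edgeSet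
    · obtain ⟨i, hi⟩ := h
      exact ⟨e.symm (Sum.inl i), by simpa [F] using hi⟩
    · push Not at h
      have hdL : d ∈ L := by
        simp only [L, Finset.mem_sdiff, SimpleGraph.mem_edgeFinset, Finset.mem_biUnion,
          Finset.mem_univ, true_and, not_exists]
        exact ⟨hd, h⟩
      exact ⟨e.symm (Sum.inr ⟨d, hdL⟩), by rw [Equiv.apply_symm_apply, hF]; rfl⟩
  · rw [e.sum_comp (fun i => Mad (F i)), Fintype.sum_sum_type]
    simp only [hMad]
    have : (L.card : ℝ) + ∑ i, ((H i).edgeSet.ncard : ℝ) = n.choose 2 := by exact_mod_cast hL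
    simp only [Finset.sum_const, Finset.card_univ, Fintype.card_coe, nsmul_eq_mul, mul_one, F,
      Sum.elim_inl]
    linarith

/-- The complete graph on the points of `T`. -/
def completeOn (T : Finset (Fin n)) : SimpleGraph (Fin n) where
  Adj x y := x ≠ y ∧ x ∈ T ∧ y ∈ T
  symm := ⟨fun _ _ h => ⟨h.1.symm, h.2.2, h.2.1⟩⟩
  loopless := ⟨fun _ h => h.1 rfl⟩

theorem iso_completeOn {T : Finset (Fin n)} (hT : T.card = 3) :
    Graph.Iso (supp (completeOn T)) (K 3) := by
  obtain ⟨a, b, c, hab, hac, hbc, rfl⟩ := Finset.card_eq_three.1 hT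
  refine iso_K_three_of_edgeSet hab hac hbc ?_
  ext e
  induction e with | _ x y
  simp only [completeOn, SimpleGraph.mem_edgeSet, Finset.mem_insert, Finset.mem_singleton,
    Set.mem_insert_iff, Set.mem_singleton_iff, Sym2.eq_iff]
  constructor
  · rintro ⟨hne, rfl | rfl | rfl, rfl | rfl | rfl⟩ <;> simp_all
  · rintro ((⟨rfl, rfl⟩ | ⟨rfl, rfl⟩) | (⟨rfl, rfl⟩ | ⟨rfl, rfl⟩) | (⟨rfl, rfl⟩ | ⟨rfl, rfl⟩)) <;>
      simp_all [eq_comm]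

theorem disjoint_completeOn {𝒯 : Finset (Finset (Fin n))}
    (h : IsTriplePacking Finset.univ 𝒯) {T U : Finset (Fin n)} (hT : T ∈ 𝒯) (hU : U ∈ 𝒯)
    (hne : T ≠ U) : Disjoint (completeOn T).edgeSet (completeOn U).edgeSet := by
  rw [Set.disjoint_left]
  intro e
  induction e with | _ x y
  rintro ⟨h1, h2, h3⟩ ⟨-, h4, h5⟩
  exact hne (h.unique T hT U hU x y h1 h2 h3 h4 h5)

/-- A graph with more than `n / 2` edges has a vertex with two neighbours. -/
theorem exists_two_adj (G : SimpleGraph (Fin n)) (h : n < 2 * G.edgeSet.ncard) :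
    ∃ a b c, a ≠ c ∧ G.Adj a b ∧ G.Adj b c := by
  classical
  rw [← SimpleGraph.coe_edgeFinset, Set.ncard_coe_finset,
    ← SimpleGraph.sum_degrees_eq_twice_card_edges] at h
  obtain ⟨b, -, hb⟩ : ∃ b ∈ (Finset.univ : Finset (Fin n)), 1 < G.degree b := by
    apply Finset.exists_lt_of_sum_lt
    simpa using h
  obtain ⟨a, ha, c, hc, hac⟩ := Finset.one_lt_card.1 hb
  rw [SimpleGraph.mem_neighborFinset] at ha hc
  exact ⟨a, b, c, hac, ha.symm, hc⟩

theorem exists_madSum_even {k s : ℕ} (hk : k + 2 * s = n.choose 2)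
    (hP : HasTriplePacking n s) : ∃ x ∈ madSums k n, (n.choose 2 : ℝ) - s ≤ x := by
  obtain ⟨𝒯, hcard, h𝒯⟩ := hP.exists_fin
  have hT : ∀ T : 𝒯, Mad (completeOn T.1) = 2 ∧ (completeOn T.1).edgeSet.ncard = 3 := fun T =>
    Mad_of_iso_K_three (iso_completeOn (h𝒯.card T.1 T.2))
  obtain ⟨x, hx, hx'⟩ := exists_decomposition (fun T : 𝒯 => completeOn T.1) k
    (fun T U hTU => disjoint_completeOn h𝒯 T.2 U.2 fun h => hTU (Subtype.ext h))
    (by simp [hT, hcard]; omega)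
  refine ⟨x, hx, ?_⟩
  simp only [hT, Finset.sum_const, Finset.card_univ, Fintype.card_coe, hcard, nsmul_eq_mul] at hx'
  push_cast at hx'
  linarith

/-- `hs` says that more than n/2 edges lie outside the s triangles, so by `exists_two_adj` a P_3 can
be taken from them. It has two edges and Mad 4/3, hence the loss of 2/3. -/
theorem exists_madSum_odd {k s : ℕ} (hk : k + (2 * s + 1) = n.choose 2)
    (hs : n + 6 * s < 2 * n.choose 2) (hP : HasTriplePacking n s) :
    ∃ x ∈ madSums k n, (n.choose 2 : ℝ) - s - 2 / 3 ≤ x := by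
  classical
  obtain ⟨𝒯, hcard, h𝒯⟩ := hP.exists_fin
  have hT : ∀ T : 𝒯, Mad (completeOn T.1) = 2 ∧ (completeOn T.1).edgeSet.ncard = 3 := fun T =>
    Mad_of_iso_K_three (iso_completeOn (h𝒯.card T.1 T.2))
  let L : SimpleGraph (Fin n) := SimpleGraph.fromEdgeSet
    ((⊤ : SimpleGraph (Fin n)).edgeSet \ ⋃ T : 𝒯, (completeOn T.1).edgeSet)
  have hLE : L.edgeSet =
      (⊤ : SimpleGraph (Fin n)).edgeSet \ ⋃ T : 𝒯, (completeOn T.1).edgeSet := by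
    simp only [L, SimpleGraph.edgeSet_fromEdgeSet]
    rw [sdiff_eq_left, Set.disjoint_left]
    rintro e ⟨he, -⟩
    exact SimpleGraph.not_isDiag_of_mem_edgeSet _ he
  have hLcard : n < 2 * L.edgeSet.ncard := by
    have h1 : (⋃ T : 𝒯, (completeOn T.1).edgeSet).ncard = 3 * s := by
      rw [Set.ncard_iUnion_of_finite (fun _ => Set.toFinite _), finsum_eq_sum_of_fintype]
      · simp [hT, hcard, mul_comm]
      · exact fun T U hTU => disjoint_completeOn h𝒯 T.2 U.2 fun h => hTU (Subtype.ext h)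
    have h2 := Set.ncard_sdiff_add_ncard_of_subset
      (Set.iUnion_subset fun T : 𝒯 => SimpleGraph.edgeSet_mono (le_top (a := completeOn T.1)))
    rw [← hLE, h1, ncard_edgeSet_top] at h2
    omega
  obtain ⟨a, b, c, hac, hab, hbc⟩ := exists_two_adj L hLcard
  let Q : SimpleGraph (Fin n) := SimpleGraph.fromEdgeSet {s(a, b), s(b, c)}
  have hQE : Q.edgeSet = {s(a, b), s(b, c)} := by
    simp only [Q, SimpleGraph.edgeSet_fromEdgeSet]
    rw [sdiff_eq_left, Set.disjoint_left]
    rintro e (rfl | rfl)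
    · simpa using hab.ne
    · simpa using hbc.ne
  have hQ := Mad_of_iso_P_three (iso_P_three_of_edgeSet hab.ne hac hbc.ne hQE)
  have hQL : Q.edgeSet ⊆ L.edgeSet := by
    rw [hQE]
    rintro e (rfl | rfl)
    exacts [hab, hbc]
  have hQT : ∀ T : 𝒯, Disjoint Q.edgeSet (completeOn T.1).edgeSet := by
    intro T
    rw [Set.disjoint_left]
    intro e he he'
    have := hQL he
    rw [hLE] at this
    exact this.2 (Set.mem_iUnion.2 ⟨T, he'⟩)
  obtain ⟨x, hx, hx'⟩ := exists_decomposition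
    (fun o : Option 𝒯 => o.elim Q fun T => completeOn T.1) k (by
      rintro (_ | T) (_ | U) hTU
      · exact absurd rfl hTU
      · exact hQT U
      · exact (hQT T).symm
      · exact disjoint_completeOn h𝒯 T.2 U.2 fun h => hTU (congrArg some (Subtype.ext h)))
    (by simp [Fintype.sum_option, hT, hQ, hcard]; omega)
  refine ⟨x, hx, ?_⟩
  simp only [Fintype.sum_option, Option.elim_none, Option.elim_some, hQ, hT, Finset.sum_const,
    Finset.card_univ, Fintype.card_coe, hcard, nsmul_eq_mul] at hx'
  push_cast at hx'
  linarith

end Existence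

/-- The existence part: the extremal value is reached. -/
theorem exists_madSum {n k t : ℕ} (hk : k + t = n.choose 2)
    (ht : (t : ℝ) ≤ ((n : ℝ) - 1) ^ 2 / 3) : ∃ x ∈ madSums k n,
      (n.choose 2 : ℝ) - ((t / 2 : ℕ) : ℝ) - 2 / 3 * ((t % 2 : ℕ) : ℝ) ≤ x := by
  rcases n with _ | n
  -- For n = 0 the real number (n - 1)² is 1, not the square of a natural predecessor, so this case
  -- is separate.
  · simp only [Nat.choose_zero_succ] at hk
    obtain rfl : t = 0 := by omega
    simpa using exists_madSum_even (n := 0) (s := 0) hk (HasTriplePacking.zero 0)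
  have ht' : 3 * t ≤ n ^ 2 := by
    have : (3 : ℝ) * t ≤ (n : ℝ) ^ 2 := by
      push_cast at ht
      rw [add_sub_cancel_right] at ht
      linarith
    exact_mod_cast this
  have hP := hasTriplePacking_of_le n (t / 2) (by omega)
  rcases Nat.mod_two_eq_zero_or_one t with h | h
  · rw [h]
    simpa using exists_madSum_even (s := t / 2) (by omega) hP
  · rw [h]
    -- With n + 1 points and t = 2s + 1, 6s = 3t - 3 ≤ n² - 3, so (n + 1) + 6s < (n + 1)n.
    have hc := two_mul_choose_two n
    simpa using exists_madSum_odd (s := t / 2) (by omega) (by nlinarith [Nat.div_add_mod t 2]) hP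

end MadDecomp

theorem theorem4p4 (n k t : ℕ) (hk : k + t = n.choose 2)
    (ht : (t : ℝ) ≤ ((n : ℝ) - 1) ^ 2 / 3) :
    (Even t →
      MadDecomp.M k n = (n.choose 2 : ℝ) - (t : ℝ) / 2 ∧
      MadDecomp.IsUniqueExtremal k n
        (Multiset.replicate (t / 2) (MadDecomp.K 3) +
          Multiset.replicate (n.choose 2 - 3 * (t / 2)) (MadDecomp.K 2))) ∧
    (Odd t →
      MadDecomp.M k n = (n.choose 2 : ℝ) - ((t : ℝ) + 1) / 2 + 1 / 3 ∧
      MadDecomp.IsUniqueExtremal k n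
        (Multiset.replicate ((t - 1) / 2) (MadDecomp.K 3) +
          Multiset.replicate (n.choose 2 - 2 - 3 * ((t - 1) / 2)) (MadDecomp.K 2) +
          {MadDecomp.P 3})) := by
  obtain ⟨hM, hU⟩ := MadDecomp.isUniqueExtremal_of_exists hk (MadDecomp.exists_madSum hk ht)
  constructor
  · rintro ⟨s, rfl⟩
    have h1 : (s + s) / 2 = s := by omega
    have h2 : (s + s) % 2 = 0 := by omega
    rw [h1, h2] at hM hU
    rw [h1]
    refine ⟨by rw [hM]; push_cast; ring, ?_⟩
    simpa [MadDecomp.smallGraphs] using hU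
  · rintro ⟨s, rfl⟩
    have h1 : (2 * s + 1) / 2 = s := by omega
    have h2 : (2 * s + 1) % 2 = 1 := by omega
    have h3 : (2 * s + 1 - 1) / 2 = s := by omega
    rw [h1, h2] at hM hU
    rw [h3]
    refine ⟨by rw [hM]; push_cast; ring, ?_⟩
    simpa [MadDecomp.smallGraphs] using hU
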